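/- Let $E$ be a real Banach lattice with the weak Dunford--Pettis property, that is, every weakly compact (bounded linear) operator from $E$ into any Banach space maps weakly null sequences of pairwise disjoint vectors of $E$ to norm null sequences. Let $(x_j)_{j=1}^\infty$ be a weakly null sequence in $E$ with $x_j \geq 0$ for every $j$. Then $P(x_j) \to 0$ for every $n \geq 1$ and every regular $n$-homogeneous polynomial $P \colon E \to \mathbb{R}$. Here an $n$-homogeneous polynomial $P\colon E \to \mathbb{R}$ is a function of the form $P(x) = A(x,\ldots,x)$ with $A \colon E^n \to \mathbb{R}$ a symmetric $n$-linear form (which is then uniquely determined by $P$); $P$ is positive if $A(y_1,\ldots,y_n) \geq 0$ whenever $y_1,\ldots,y_n \geq 0$, and $P$ is regular if it is the difference of two positive $n$-homogeneous polynomials. -/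

import Mathlib

open Filter Topology

universe u

namespace BanachLattice

/-- A sequence `x` in a real normed space is weakly null if `f (x j) → 0` for every bounded
linear functional `f`. -/
def WeaklyNull {E : Type u} [NormedAddCommGroup E] [NormedSpace ℝ E] (x : ℕ → E) : Prop :=
  ∀ f : StrongDual ℝ E, Tendsto (fun j => f (x j)) atTop (𝓝 0)

/-- A bounded linear operator is weakly compact if it maps the closed unit ball onto a set whose
closure in the weak topology is weakly compact. -/
def IsWeaklyCompactOperator {E F : Type u} [NormedAddCommGroup E] [NormedSpace ℝ E]
    [NormedAddCommGroup F] [NormedSpace ℝ F] (T : E →L[ℝ] F) : Prop :=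
  IsCompact (closure ((fun x : E => toWeakSpace ℝ F (T x)) '' Metric.closedBall (0 : E) 1))

/-- The weak Dunford-Pettis property: every weakly compact operator into any Banach space maps
weakly null sequences of pairwise disjoint vectors to norm null sequences. -/
def HasWeakDunfordPettis (E : Type u) [NormedAddCommGroup E] [NormedSpace ℝ E] [Lattice E] :
    Prop :=
  ∀ (F : Type u) [NormedAddCommGroup F] [NormedSpace ℝ F] [CompleteSpace F] (T : E →L[ℝ] F),
    IsWeaklyCompactOperator T →
    ∀ x : ℕ → E, WeaklyNull x → (∀ i j, i ≠ j → |x i| ⊓ |x j| = 0) →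
      Tendsto (fun j => ‖T (x j)‖) atTop (𝓝 0)

/-- `P` is a positive `n`-homogeneous polynomial: `P x = A (x, …, x)` for a symmetric `n`-linear
form `A` (unique, by polarization) which is positive, i.e. nonnegative on tuples of positive
vectors. -/
def IsPositivePolynomial {E : Type u} [AddCommGroup E] [Module ℝ E] [Lattice E]
    (n : ℕ) (P : E → ℝ) : Prop :=
  ∃ A : MultilinearMap ℝ (fun _ : Fin n => E) ℝ,
    (∀ (σ : Equiv.Perm (Fin n)) (v : Fin n → E), A (fun i => v (σ i)) = A v) ∧
    (∀ v : Fin n → E, (∀ i, 0 ≤ v i) → 0 ≤ A v) ∧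
    ∀ x : E, P x = A (fun _ => x)

/-- A regular `n`-homogeneous polynomial is a difference of two positive ones. -/
def IsRegularPolynomial {E : Type u} [AddCommGroup E] [Module ℝ E] [Lattice E]
    (n : ℕ) (P : E → ℝ) : Prop :=
  ∃ P₁ P₂ : E → ℝ, IsPositivePolynomial n P₁ ∧ IsPositivePolynomial n P₂ ∧
    ∀ x : E, P x = P₁ x - P₂ x

end BanachLattice

/-! Induct on the degree. Freezing all but one variable at `x j`, a positive form `A` gives positive
functionals `f j` with `A (x j, …, x j) = f j (x j)`. Composing the curried form with a positive
functional on the dual lowers the degree, so by induction `f j → 0` pointwise on `E` and against the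
positive bidual ball. Hence `y ↦ (f j y)` is a weakly compact operator into `c₀`
(`isWeaklyCompactOperator_nullOperator`). If `f j (x j)` did not tend to zero,
`exists_disjoint_of_frequently` would give disjoint `0 ≤ v n ≤ x (φ n)` with `f (φ n) (v n)` bounded
below. Such a `v` is weakly null, so the weak Dunford-Pettis property sends its images to zero in
norm, a contradiction. -/

namespace BanachLattice

/-! ### Positive parts and positive functionals -/

section OrderedGroup
variable {E : Type*} [AddCommGroup E] [Lattice E] [IsOrderedAddMonoid E]

theorem posPart_add_le_add (a b : E) : (a + b)⁺ ≤ a⁺ + b⁺ :=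
  sup_le (add_le_add (le_posPart a) (le_posPart b))
    (add_nonneg (posPart_nonneg a) (posPart_nonneg b))

theorem map_mono_of_nonneg {F : Type*} [FunLike F E ℝ] [AddMonoidHomClass F E ℝ] {f : F}
    (hf : ∀ y, 0 ≤ y → 0 ≤ f y) {a b : E} (h : a ≤ b) : f a ≤ f b := by
  have := hf (b - a) (sub_nonneg.2 h)
  rw [map_sub] at this
  linarith

end OrderedGroup

section OrderedModule
variable {E : Type*} [AddCommGroup E] [Module ℝ E] [Lattice E] [IsOrderedModule ℝ E]

theorem smul_posPart_of_pos {c : ℝ} (hc : 0 < c) (a : E) : (c • a)⁺ = c • a⁺ := by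
  apply le_antisymm
  · exact sup_le (smul_le_smul_of_nonneg_left (le_posPart a) hc.le)
      (smul_nonneg hc.le (posPart_nonneg a))
  · rw [← le_inv_smul_iff_of_pos hc]
    refine sup_le ?_ (smul_nonneg (inv_nonneg.2 hc.le) (posPart_nonneg _))
    rw [le_inv_smul_iff_of_pos hc]
    exact le_posPart _

/-- With `t = K • (b - c • a)`, the two vectors lie below `t⁻` and `t⁺`, which are disjoint. -/
theorem posPart_sub_smul_inf_posPart_sub_smul [IsOrderedAddMonoid E] {a b : E} (ha : 0 ≤ a) {c K : ℝ} (hK : 1 ≤ K)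
    (hcK : 1 ≤ K * c) : (a - K • b)⁺ ⊓ (b - c • a)⁺ = 0 := by
  have hK0 : 0 < K := one_pos.trans_le hK
  set t : E := K • (b - c • a) with ht
  have h1 : (a - K • b)⁺ ≤ t⁻ := by
    rw [← posPart_neg]
    refine posPart_mono ?_
    have h : (0 : E) ≤ (K * c - 1) • a := smul_nonneg (sub_nonneg.2 hcK) ha
    have h' : -t = (a - K • b) + (K * c - 1) • a := by rw [ht]; module
    rw [h']
    exact le_add_of_nonneg_right h
  have h2 : (b - c • a)⁺ ≤ t⁺ := by
    rw [ht, smul_posPart_of_pos hK0]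
    exact le_smul_of_one_le_left (posPart_nonneg _) hK
  refine le_antisymm ?_ (le_inf (posPart_nonneg _) (posPart_nonneg _))
  calc _ ≤ t⁻ ⊓ t⁺ := inf_le_inf h1 h2
    _ = 0 := by rw [inf_comm, posPart_inf_negPart_eq_zero]

end OrderedModule

section NormedLattice
variable {E : Type*} [NormedAddCommGroup E] [Lattice E] [HasSolidNorm E] [IsOrderedAddMonoid E]

theorem norm_le_norm_of_nonneg_of_le {a b : E} (ha : 0 ≤ a) (h : a ≤ b) : ‖a‖ ≤ ‖b‖ :=
  norm_le_norm_of_abs_le_abs (by rwa [abs_of_nonneg ha, abs_of_nonneg (ha.trans h)])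

theorem norm_posPart_le (a : E) : ‖a⁺‖ ≤ ‖a‖ := by
  have h : a⁺ ≤ |a| := sup_le (le_abs_self a) (abs_nonneg a)
  exact (norm_le_norm_of_nonneg_of_le (posPart_nonneg a) h).trans (norm_abs_eq_norm a).le

theorem norm_negPart_le (a : E) : ‖a⁻‖ ≤ ‖a‖ := by
  simpa using norm_posPart_le (-a)

end NormedLattice

section NormedSpace
variable {E : Type*} [NormedAddCommGroup E] [NormedSpace ℝ E] [Lattice E] [HasSolidNorm E]
  [IsOrderedAddMonoid E] [IsOrderedModule ℝ E]

/-- A bounded functional on a normed lattice is a sum of a positive and a negative one. -/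
theorem exists_eq_sub_of_nonneg (f : StrongDual ℝ E) : ∃ g h : StrongDual ℝ E,
    (∀ y, 0 ≤ y → 0 ≤ g y) ∧ (∀ y, 0 ≤ y → 0 ≤ h y) ∧ f = g - h := by
  -- Hahn-Banach on `E × E`: extend `f` from the diagonal under a sublinear bound vanishing at `(-y,
  -- 0)` and `(0, y)` for `y ≥ 0`. The restrictions of the extension to the two axes are then `g ≥
  -- 0` and `f - g ≤ 0`.
  have hinj : Function.Injective (LinearMap.id.prod LinearMap.id : E →ₗ[ℝ] E × E) :=
    fun a b hab => congrArg Prod.fst hab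
  let p : E × E →ₗ.[ℝ] ℝ :=
    ⟨LinearMap.range (LinearMap.id.prod LinearMap.id : E →ₗ[ℝ] E × E),
      f.toLinearMap ∘ₗ (LinearEquiv.ofInjective _ hinj).symm.toLinearMap⟩
  obtain ⟨F, hF, hFle⟩ := exists_extension_of_le_sublinear p
    (fun z => ‖f‖ * ‖z.1⁺ + z.2⁻‖)
    (fun c hc z => by
      have : (c • z).2⁻ = c • z.2⁻ := by
        rw [← posPart_neg, ← posPart_neg, ← smul_posPart_of_pos hc, Prod.smul_snd, smul_neg]
      rw [this, Prod.smul_fst, smul_posPart_of_pos hc, ← smul_add, norm_smul,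
        Real.norm_of_nonneg hc.le]
      ring)
    (fun z w => by
      rw [← mul_add]
      refine mul_le_mul_of_nonneg_left ((norm_le_norm_of_nonneg_of_le
        (add_nonneg (posPart_nonneg _) (negPart_nonneg _)) ?_).trans (norm_add_le _ _))
        (norm_nonneg _)
      have h2 : (z + w).2⁻ ≤ z.2⁻ + w.2⁻ := by
        simp only [← posPart_neg, Prod.snd_add, neg_add]
        exact posPart_add_le_add _ _
      calc _ ≤ (z.1⁺ + w.1⁺) + (z.2⁻ + w.2⁻) := add_le_add (posPart_add_le_add _ _) h2
        _ = _ := by abel)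
    (by
      rintro ⟨_, a, rfl⟩
      have : p ⟨_, a, rfl⟩ = f a :=
        congrArg f ((LinearEquiv.ofInjective _ hinj).symm_apply_apply a)
      rw [this]
      refine (le_abs_self _).trans ((f.le_opNorm a).trans (le_of_eq ?_))
      change ‖f‖ * ‖a‖ = ‖f‖ * ‖a⁺ + a⁻‖
      rw [posPart_add_negPart, norm_abs_eq_norm])
  have hdiag (a : E) : F (a, a) = f a :=
    (hF ⟨_, a, rfl⟩).trans (congrArg f ((LinearEquiv.ofInjective _ hinj).symm_apply_apply a))
  have hbd1 (a : E) : F (a, 0) ≤ ‖f‖ * ‖a‖ := (hFle (a, 0)).trans <| by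
    simpa using mul_le_mul_of_nonneg_left (norm_posPart_le a) (norm_nonneg f)
  let g : StrongDual ℝ E := (F ∘ₗ LinearMap.inl ℝ E E).mkContinuous ‖f‖ fun a =>
    abs_le.2 ⟨by
      have := hbd1 (-a)
      have e : ((-a, 0) : E × E) = -(a, 0) := by simp
      rw [e, map_neg, norm_neg] at this
      change -_ ≤ F (a, 0)
      linarith, hbd1 a⟩
  have hg (a : E) : g a = F (a, 0) := rfl
  refine ⟨g, g - f, fun y hy => ?_, fun y hy => ?_, by abel⟩
  · have := hFle (-y, 0)
    have e : ((-y, 0) : E × E) = -(y, 0) := by simp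
    rw [e, map_neg] at this
    have e2 : (-y)⁺ = 0 := by simpa using hy
    simp [e2] at this
    rw [hg]; exact this
  · have := hFle (0, y)
    have e2 : y⁻ = 0 := negPart_eq_zero.2 hy
    simp only [posPart_zero, e2, add_zero, norm_zero, mul_zero] at this
    have e : ((y, y) : E × E) = (y, 0) + (0, y) := by simp
    have h := hdiag y
    rw [e, map_add] at h
    rw [sub_apply, hg]
    linarith

theorem WeaklyNull.of_nonneg_of_le {x v : ℕ → E} (hx : WeaklyNull x) (hv : ∀ n, 0 ≤ v n)
    (hvx : ∀ n, v n ≤ x n) : WeaklyNull v := by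
  intro f
  obtain ⟨g, h, hg, hh, rfl⟩ := exists_eq_sub_of_nonneg f
  have key (k : StrongDual ℝ E) (hk : ∀ y, 0 ≤ y → 0 ≤ k y) :
      Tendsto (fun n => k (v n)) atTop (𝓝 0) :=
    squeeze_zero (fun n => hk _ (hv n)) (fun n => map_mono_of_nonneg hk (hvx n)) (hx k)
  simpa using (key g hg).sub (key h hh)

end NormedSpace

section Bounded
variable {E : Type*} [NormedAddCommGroup E] [NormedSpace ℝ E]

theorem WeaklyNull.exists_norm_le {x : ℕ → E} (hx : WeaklyNull x) : ∃ M, ∀ n, ‖x n‖ ≤ M := by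
  obtain ⟨M, hM⟩ := banach_steinhaus (g := fun n => NormedSpace.inclusionInDoubleDual ℝ E (x n))
    (fun f => by
      obtain ⟨C, hC⟩ := (hx f).norm.bddAbove_range
      exact ⟨C, fun n => hC ⟨n, rfl⟩⟩)
  refine ⟨M, fun n => ?_⟩
  have := (NormedSpace.inclusionInDoubleDualLi ℝ (E := E)).norm_map (x n)
  rw [← this]
  exact hM n

end Bounded

/-! ### Automatic continuity and disjointification -/

section Complete
variable {E : Type*} [NormedAddCommGroup E] [NormedSpace ℝ E] [Lattice E] [HasSolidNorm E]
  [IsOrderedAddMonoid E] [IsOrderedModule ℝ E] [CompleteSpace E]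

theorem exists_forall_smul_le {x : ℕ → E} (hx : ∀ n, 0 ≤ x n) {M : ℝ} (hM : ∀ n, ‖x n‖ ≤ M)
    {c : ℕ → ℝ} (hc : ∀ n, 0 ≤ c n) (hs : Summable c) :
    ∃ y : E, 0 ≤ y ∧ ∀ n, c n • x n ≤ y := by
  have hsum : Summable fun n => c n • x n :=
    Summable.of_norm_bounded (hs.mul_right M) fun n => by
      rw [norm_smul, Real.norm_of_nonneg (hc n)]
      exact mul_le_mul_of_nonneg_left (hM n) (hc n)
  have h0 (n : ℕ) : 0 ≤ c n • x n := smul_nonneg (hc n) (hx n)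
  exact ⟨∑' n, c n • x n, tsum_nonneg h0, fun n => hsum.le_tsum n fun m _ => h0 m⟩

theorem exists_bound_of_nonneg (f : E →ₗ[ℝ] ℝ) (hf : ∀ y, 0 ≤ y → 0 ≤ f y) :
    ∃ C, ∀ y, ‖f y‖ ≤ C * ‖y‖ := by
  obtain ⟨C, hC⟩ : ∃ C, ∀ y, 0 ≤ y → ‖y‖ ≤ 1 → f y ≤ C := by
    -- If `f (x n) > 4 ^ n` on the unit ball, a single `y` dominating every `2⁻ⁿ • x n` would have
    -- `f y ≥ 2 ^ n` for all `n`.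
    by_contra! H
    choose x hx hx1 hxf using fun n : ℕ => H (4 ^ n)
    obtain ⟨y, -, hy⟩ := exists_forall_smul_le hx hx1 (c := fun n => (1 / 2) ^ n)
      (fun n => by positivity) summable_geometric_two
    have h (n : ℕ) : (2 : ℝ) ^ n ≤ f y := by
      have h1 := map_mono_of_nonneg hf (hy n)
      rw [map_smul, smul_eq_mul] at h1
      calc (2 : ℝ) ^ n = (1 / 2) ^ n * 4 ^ n := by rw [← mul_pow]; norm_num
        _ ≤ (1 / 2) ^ n * f (x n) := by gcongr; exact (hxf n).le
        _ ≤ f y := h1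
    obtain ⟨n, hn⟩ := pow_unbounded_of_one_lt (f y) one_lt_two
    exact absurd (h n) (not_le.2 hn)
  have h1 (y : E) (hy : 0 ≤ y) : f y ≤ C * ‖y‖ := by
    rcases eq_or_ne y 0 with rfl | h0
    · simp
    have hp : 0 < ‖y‖ := norm_pos_iff.2 h0
    have := hC (‖y‖⁻¹ • y) (smul_nonneg (by positivity) hy)
      (by rw [norm_smul, norm_inv, norm_norm, inv_mul_cancel₀ hp.ne'])
    rw [map_smul, smul_eq_mul, inv_mul_le_iff₀ hp] at this
    linarith
  have hC0 : 0 ≤ C := by simpa using hC 0 le_rfl (by simp)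
  refine ⟨C, fun y => abs_le.2 ?_⟩
  have hp := (h1 _ (posPart_nonneg y)).trans
    (mul_le_mul_of_nonneg_left (norm_posPart_le y) hC0)
  have hn := (h1 _ (negPart_nonneg y)).trans
    (mul_le_mul_of_nonneg_left (norm_negPart_le y) hC0)
  have h2 := hf _ (posPart_nonneg y)
  have h3 := hf _ (negPart_nonneg y)
  have h4 : f y = f y⁺ - f y⁻ := by rw [← map_sub, posPart_sub_negPart]
  constructor <;> linarith

/-- If positive functionals `f n` tend to zero pointwise but `f n (x n)` stays away from zero along
a bounded positive sequence, then the `x n` can be replaced by smaller disjoint vectors along a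
subsequence. -/
theorem exists_disjoint_of_frequently {x : ℕ → E} (hx : ∀ n, 0 ≤ x n) {M : ℝ}
    (hM : ∀ n, ‖x n‖ ≤ M) {f : ℕ → StrongDual ℝ E} (hf : ∀ n y, 0 ≤ y → 0 ≤ f n y)
    (hf0 : ∀ y, Tendsto (fun n => f n y) atTop (𝓝 0)) {ε : ℝ} (hε : 0 < ε)
    (h : ∃ᶠ n in atTop, ε ≤ f n (x n)) :
    ∃ (φ : ℕ → ℕ) (v : ℕ → E), StrictMono φ ∧ (∀ n, 0 ≤ v n) ∧ (∀ n, v n ≤ x (φ n)) ∧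
      (∀ i j, i ≠ j → v i ⊓ v j = 0) ∧ ∀ᶠ n in atTop, ε / 4 ≤ f (φ n) (v n) := by
  -- The recursion sees only the set of earlier terms, not its position, so the exponent `m n` is
  -- chosen together with the index `φ n`.
  obtain ⟨q, hq, hr⟩ := exists_seq_of_forall_finset_exists
    (fun a : ℕ × ℕ => ε ≤ f a.2 (x a.2))
    (fun a b : ℕ × ℕ => a.1 < b.1 ∧ a.2 < b.2 ∧
      4 ^ b.1 * f b.2 (x a.2) ≤ ε / 4 * (1 / 2) ^ a.1)
    (fun s _ => by
      obtain ⟨m, hm⟩ : ∃ m, ∀ a ∈ s, a.1 < m :=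
        ⟨s.sup Prod.fst + 1, fun a ha => Nat.lt_succ_of_le (Finset.le_sup (f := Prod.fst) ha)⟩
      have hev : ∀ᶠ j in atTop, ∀ a ∈ s, a.2 < j ∧
          4 ^ m * f j (x a.2) ≤ ε / 4 * (1 / 2) ^ a.1 := by
        rw [Finset.eventually_all]
        intro a _
        refine (eventually_gt_atTop a.2).and ?_
        have h1 := (hf0 (x a.2)).const_mul ((4 : ℝ) ^ m)
        rw [mul_zero] at h1
        exact h1.eventually_le_const (by positivity)
      obtain ⟨j, hj1, hj2⟩ := (h.and_eventually hev).exists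
      exact ⟨(m, j), hj1, fun a ha => ⟨hm a ha, hj2 a ha⟩⟩)
  let m : ℕ → ℕ := fun n => (q n).1
  let φ : ℕ → ℕ := fun n => (q n).2
  have hm : StrictMono m := strictMono_nat_of_lt_succ fun n => (hr n _ n.lt_succ_self).1
  have hφ : StrictMono φ := strictMono_nat_of_lt_succ fun n => (hr n _ n.lt_succ_self).2.1
  have hmle (n : ℕ) : ((1 : ℝ) / 2) ^ m n ≤ (1 / 2) ^ n :=
    pow_le_pow_of_le_one (by norm_num) (by norm_num) (hm.le_apply)
  obtain ⟨y, hy0, hy⟩ := exists_forall_smul_le (fun n => hx (φ n)) (fun n => hM (φ n))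
    (c := fun n => (1 / 2) ^ m n) (fun n => by positivity)
    (Summable.of_nonneg_of_le (fun n => by positivity) hmle summable_geometric_two)
  -- The first summand makes `v n` disjoint from earlier vectors, the second from later ones, as `y`
  -- dominates `(1 / 2) ^ m j • x (φ j)`.
  let w : ℕ → E := fun n =>
    (4 : ℝ) ^ m n • ∑ i ∈ Finset.range n, x (φ i) + ((1 : ℝ) / 2) ^ m n • y
  have hw0 (n : ℕ) : 0 ≤ w n :=
    add_nonneg (smul_nonneg (by positivity) (Finset.sum_nonneg fun i _ => hx _))
      (smul_nonneg (by positivity) hy0)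
  let v : ℕ → E := fun n => (x (φ n) - w n)⁺
  have hlt {i j : ℕ} (hij : i < j) : v j ⊓ v i = 0 := by
    refine le_antisymm ?_ (le_inf (posPart_nonneg _) (posPart_nonneg _))
    have hc : (1 : ℝ) ≤ 4 ^ m j * ((1 / 2) ^ m i * (1 / 2) ^ m j) := by
      have h1 : ((1 : ℝ) / 2) ^ m j ≤ (1 / 2) ^ m i :=
        pow_le_pow_of_le_one (by norm_num) (by norm_num) (hm hij).le
      calc (1 : ℝ) = 4 ^ m j * ((1 / 2) ^ m j * (1 / 2) ^ m j) := by
            rw [← mul_pow, ← mul_pow]; norm_num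
        _ ≤ _ := by gcongr
    refine (inf_le_inf (posPart_mono (sub_le_sub_left ?_ _))
      (posPart_mono (sub_le_sub_left ?_ _))).trans
        (posPart_sub_smul_inf_posPart_sub_smul (b := x (φ i)) (hx (φ j))
          (one_le_pow₀ (by norm_num)) hc).le
    · refine le_add_of_le_of_nonneg ?_ (smul_nonneg (by positivity) hy0)
      exact smul_le_smul_of_nonneg_left (Finset.single_le_sum (f := fun i => x (φ i))
        (fun i _ => hx _) (Finset.mem_range.2 hij)) (by positivity)
    · refine le_add_of_nonneg_of_le
        (smul_nonneg (by positivity) (Finset.sum_nonneg fun i _ => hx _)) ?_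
      rw [mul_smul]
      exact smul_le_smul_of_nonneg_left (hy j) (by positivity)
  refine ⟨φ, v, hφ, fun n => posPart_nonneg _,
    fun n => sup_le (sub_le_self _ (hw0 n)) (hx _), fun i j hij => ?_, ?_⟩
  · rcases lt_or_gt_of_ne hij with h | h
    · rw [inf_comm]; exact hlt h
    · exact hlt h
  -- Subtracting `w n` costs at most `ε / 2` from the sum and eventually `ε / 4` from `y`.
  · have hev : ∀ᶠ n in atTop, f (φ n) y ≤ ε / 4 :=
      ((hf0 y).comp hφ.tendsto_atTop).eventually_le_const (by positivity)
    filter_upwards [hev] with n hn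
    have h1 : f (φ n) (x (φ n)) - f (φ n) (w n) ≤ f (φ n) (v n) := by
      rw [← map_sub]
      exact map_mono_of_nonneg (hf _) (le_posPart _)
    have h2 : f (φ n) (w n) = ∑ i ∈ Finset.range n, 4 ^ m n * f (φ n) (x (φ i)) +
        (1 / 2) ^ m n * f (φ n) y := by
      simp [w, map_sum, Finset.mul_sum]
    have h3 : ∑ i ∈ Finset.range n, 4 ^ m n * f (φ n) (x (φ i)) ≤ ε / 4 * 2 := by
      refine (Finset.sum_le_sum fun i hi => ((hr i n (Finset.mem_range.1 hi)).2.2.trans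
        (mul_le_mul_of_nonneg_left (hmle i) (by positivity)))).trans ?_
      rw [← Finset.mul_sum]
      exact mul_le_mul_of_nonneg_left (sum_geometric_two_le n) (by positivity)
    have h4 : (1 / 2) ^ m n * f (φ n) y ≤ f (φ n) y :=
      mul_le_of_le_one_left (hf _ _ hy0) (pow_le_one₀ (by norm_num) (by norm_num))
    have h5 : ε ≤ f (φ n) (x (φ n)) := hq n
    linarith [h4.trans hn]

end Complete

/-! ### The space `c₀` and its dual -/

theorem tendsto_single_cofinite {ι : Type*} [DecidableEq ι] (i : ι) :
    Tendsto (Pi.single i (1 : ℝ) : ι → ℝ) cofinite (𝓝 0) := by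
  refine tendsto_const_nhds.congr' ?_
  filter_upwards [(Set.finite_singleton i).compl_mem_cofinite] with j hj
  exact (Pi.single_eq_of_ne (M := fun _ => ℝ) hj 1).symm

section NullFunctions
open scoped ZeroAtInfty
variable {ι : Type*} [TopologicalSpace ι]

theorem norm_zeroAtInfty_le {y : C₀(ι, ℝ)} {C : ℝ} (hC : 0 ≤ C) :
    ‖y‖ ≤ C ↔ ∀ i, ‖y i‖ ≤ C := by
  rw [← ZeroAtInftyContinuousMap.norm_toBCF_eq_norm, BoundedContinuousFunction.norm_le hC]
  rfl

theorem coe_finset_sum (s : Finset ι) (y : ι → C₀(ι, ℝ)) (i : ι) :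
    (∑ j ∈ s, y j) i = ∑ j ∈ s, y j i :=
  map_sum (⟨⟨fun z : C₀(ι, ℝ) => z i, rfl⟩, fun _ _ => rfl⟩ : C₀(ι, ℝ) →+ ℝ) y s

variable [DiscreteTopology ι]

/-- The element of `c₀` with a given family of coordinates. -/
def nullFunction (y : ι → ℝ) (hy : Tendsto y cofinite (𝓝 0)) : C₀(ι, ℝ) where
  toFun := y
  continuous_toFun := continuous_of_discreteTopology
  zero_at_infty' := by rwa [cocompact_eq_cofinite]

@[simp]
theorem nullFunction_apply (y : ι → ℝ) (hy : Tendsto y cofinite (𝓝 0)) (i : ι) :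
    nullFunction y hy i = y i := rfl

theorem finset_sum_smul_single_apply [DecidableEq ι] (s : Finset ι) (c : ι → ℝ) (i : ι) :
    (∑ j ∈ s, c j • nullFunction _ (tendsto_single_cofinite j)) i = if i ∈ s then c i else 0 := by
  rw [coe_finset_sum]
  simp [Pi.single_apply]

/-- The dual of `c₀` is `ℓ¹`. -/
theorem exists_summable_hasSum (L : StrongDual ℝ C₀(ι, ℝ)) :
    ∃ a : ι → ℝ, Summable (fun i => ‖a i‖) ∧ ∀ y : C₀(ι, ℝ), HasSum (fun i => a i * y i) (L y) := by
  classical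
  refine ⟨fun i => L (nullFunction _ (tendsto_single_cofinite i)), ?_, fun y => ?_⟩
  · refine summable_of_sum_le (fun _ => norm_nonneg _) (c := ‖L‖) fun s => ?_
    set a := fun i => L (nullFunction _ (tendsto_single_cofinite i))
    have h : ‖∑ j ∈ s, (SignType.sign (a j) : ℝ) •
        nullFunction _ (tendsto_single_cofinite j)‖ ≤ 1 := by
      rw [norm_zeroAtInfty_le zero_le_one]
      intro i
      rw [finset_sum_smul_single_apply]
      split_ifs
      · rcases SignType.sign (a i) with _ | _ | _ <;> simp
      · simp
    calc ∑ i ∈ s, ‖a i‖ = L (∑ j ∈ s, (SignType.sign (a j) : ℝ) •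
          nullFunction _ (tendsto_single_cofinite j)) := by
          rw [map_sum]
          refine Finset.sum_congr rfl fun i _ => ?_
          rw [map_smul, smul_eq_mul, Real.norm_eq_abs, ← sign_mul_self]
      _ ≤ ‖L‖ * 1 := (le_abs_self _).trans (L.le_opNorm_of_le h)
      _ = ‖L‖ := mul_one _
  · have h : HasSum (fun i => y i • nullFunction _ (tendsto_single_cofinite i)) y := by
      rw [HasSum, SummationFilter.unconditional_filter, Metric.tendsto_atTop]
      intro ε hε
      have hy : Tendsto y cofinite (𝓝 0) := by
        rw [← cocompact_eq_cofinite ι]; exact zero_at_infty y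
      have hfin := hy.eventually (Metric.ball_mem_nhds (0 : ℝ) (half_pos hε))
      rw [eventually_cofinite] at hfin
      refine ⟨hfin.toFinset, fun s hs => ?_⟩
      rw [dist_eq_norm]
      refine lt_of_le_of_lt ((norm_zeroAtInfty_le (half_pos hε).le).2 fun i => ?_)
        (half_lt_self hε)
      rw [ZeroAtInftyContinuousMap.sub_apply, finset_sum_smul_single_apply]
      split_ifs with hi
      · simpa using (half_pos hε).le
      · have : i ∉ hfin.toFinset := fun h => hi (hs h)
        simp at this
        simpa using this.le
    have h2 := h.mapL L
    simpa [mul_comm] using h2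

end NullFunctions

/-! ### Weakly compact operators into `c₀` -/

section Operator
open scoped ZeroAtInfty
variable {E : Type*} [NormedAddCommGroup E] [NormedSpace ℝ E]
variable {ι : Type*} [TopologicalSpace ι] [DiscreteTopology ι]

/-- The operator into `c₀` whose coordinates are the given functionals. -/
noncomputable def nullOperator (f : ι → StrongDual ℝ E)
    (hf : ∀ y, Tendsto (fun i => f i y) cofinite (𝓝 0)) (M : ℝ) (hM : ∀ i, ‖f i‖ ≤ M) :
    E →L[ℝ] C₀(ι, ℝ) :=
  LinearMap.mkContinuous
    { toFun := fun y => nullFunction _ (hf y)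
      map_add' := fun y z => by ext i; simp
      map_smul' := fun c y => by ext i; simp }
    (max M 0) fun y => (norm_zeroAtInfty_le (by positivity)).2 fun i =>
      (f i).le_of_opNorm_le ((hM i).trans (le_max_left _ _)) y

/-- A set of bidual functionals on which the `f i` tend to zero is mapped to `c₀` continuously for
the weak-star and the weak topology. -/
theorem continuous_nullFunction_weakDual {f : ι → StrongDual ℝ E} {M : ℝ} (hM : ∀ i, ‖f i‖ ≤ M)
    {B : Set (WeakDual ℝ (StrongDual ℝ E))}
    (hB : ∀ Φ : B, Tendsto (fun i => Φ.1 (f i)) cofinite (𝓝 0)) :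
    Continuous fun Φ : B => toWeakSpace ℝ C₀(ι, ℝ) (nullFunction _ (hB Φ)) := by
  refine WeakBilin.continuous_of_continuous_eval _ fun L => ?_
  obtain ⟨a, ha, hL⟩ := exists_summable_hasSum L
  have hsum : Summable fun i => a i • f i :=
    Summable.of_norm_bounded (ha.mul_right M) fun i => by
      rw [norm_smul]
      exact mul_le_mul_of_nonneg_left (hM i) (norm_nonneg _)
  -- Each `L` in the dual of `c₀` pulls back to evaluation at one functional, hence is weak-star
  -- continuous in `Φ`.
  have key (Φ : B) : L (nullFunction _ (hB Φ)) = Φ.1 (∑' i, a i • f i) := by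
    have h1 := hL (nullFunction _ (hB Φ))
    have h2 := hsum.hasSum.mapL (WeakDual.toStrongDual Φ.1)
    refine h1.unique ?_
    simpa using h2
  have : Continuous fun Φ : B => Φ.1 (∑' i, a i • f i) :=
    (WeakDual.eval_continuous _).comp continuous_subtype_val
  exact this.congr fun Φ => (key Φ).symm

variable [Lattice E]

/-- The positive part of the closed unit ball of the bidual. -/
def positiveBidualBall (E : Type*) [NormedAddCommGroup E] [NormedSpace ℝ E] [Lattice E] :
    Set (WeakDual ℝ (StrongDual ℝ E)) :=
  WeakDual.toStrongDual ⁻¹' Metric.closedBall 0 1 ∩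
    {Φ | ∀ g : StrongDual ℝ E, (∀ y, 0 ≤ y → 0 ≤ g y) → 0 ≤ Φ g}

theorem isCompact_positiveBidualBall : IsCompact (positiveBidualBall E) := by
  refine (WeakDual.isCompact_closedBall 0 1).inter_right ?_
  simp only [Set.ofPred_forall]
  exact isClosed_iInter fun g => isClosed_iInter fun _ =>
    isClosed_le continuous_const (WeakDual.eval_continuous g)

theorem inclusionInDoubleDual_mem_positiveBidualBall {y : E} (hy : 0 ≤ y) (h : ‖y‖ ≤ 1) :
    StrongDual.toWeakDual (NormedSpace.inclusionInDoubleDual ℝ E y) ∈ positiveBidualBall E := by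
  refine ⟨?_, fun g hg => hg y hy⟩
  have := (NormedSpace.inclusionInDoubleDualLi ℝ (E := E)).norm_map y
  exact (mem_closedBall_zero_iff (E := StrongDual ℝ (StrongDual ℝ E))).2 (this.le.trans h)

/-- The positive bidual ball has weakly compact image `K`. Splitting `y = y⁺ - y⁻` puts the image of
the unit ball in `K - K`. -/
theorem isWeaklyCompactOperator_nullOperator {E ι : Type u} [NormedAddCommGroup E]
    [NormedSpace ℝ E] [Lattice E] [HasSolidNorm E] [IsOrderedAddMonoid E]
    [TopologicalSpace ι] [DiscreteTopology ι]
    (f : ι → StrongDual ℝ E) (hf : ∀ y, Tendsto (fun i => f i y) cofinite (𝓝 0))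
    (M : ℝ) (hM : ∀ i, ‖f i‖ ≤ M)
    (hB : ∀ Φ : positiveBidualBall E, Tendsto (fun i => Φ.1 (f i)) cofinite (𝓝 0)) :
    IsWeaklyCompactOperator (nullOperator f hf M hM) := by
  have : CompactSpace (positiveBidualBall E) :=
    isCompact_iff_compactSpace.1 isCompact_positiveBidualBall
  have hK := isCompact_range (continuous_nullFunction_weakDual hM hB)
  refine ((hK.prod hK).image
    (f := fun p : WeakSpace ℝ C₀(ι, ℝ) × WeakSpace ℝ C₀(ι, ℝ) => p.1 - p.2) continuous_sub).closure_of_subset ?_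
  rintro _ ⟨y, hy, rfl⟩
  rw [mem_closedBall_zero_iff] at hy
  refine ⟨(_, _), ⟨⟨⟨_, inclusionInDoubleDual_mem_positiveBidualBall (posPart_nonneg y)
    ((norm_posPart_le y).trans hy)⟩, rfl⟩, ⟨⟨_, inclusionInDoubleDual_mem_positiveBidualBall
    (negPart_nonneg y) ((norm_negPart_le y).trans hy)⟩, rfl⟩⟩, ?_⟩
  refine sub_eq_of_eq_add (congrArg (toWeakSpace ℝ C₀(ι, ℝ)) (?_ : nullFunction _ (hf y⁺) =
    nullOperator f hf M hM y + nullFunction _ (hf y⁻)))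
  ext i
  have h : f i y = f i y⁺ - f i y⁻ := by rw [← map_sub, posPart_sub_negPart]
  exact (sub_eq_iff_eq_add.1 h.symm)

end Operator

/-! ### Induction on the degree -/

section Polynomial
variable {E : Type u} [NormedAddCommGroup E] [NormedSpace ℝ E] [CompleteSpace E]
    [Lattice E] [HasSolidNorm E] [IsOrderedAddMonoid E] [IsOrderedModule ℝ E]

theorem HasWeakDunfordPettis.tendsto_apply (hE : HasWeakDunfordPettis E) {x : ℕ → E}
    (hx : ∀ n, 0 ≤ x n) (hnull : WeaklyNull x) {f : ℕ → StrongDual ℝ E}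
    (hf : ∀ n y, 0 ≤ y → 0 ≤ f n y) (hf0 : ∀ y, Tendsto (fun n => f n y) atTop (𝓝 0))
    (hΦ : ∀ Φ ∈ positiveBidualBall E, Tendsto (fun n => Φ (f n)) atTop (𝓝 0)) :
    Tendsto (fun n => f n (x n)) atTop (𝓝 0) := by
  -- `ULift` places `c₀` in the universe of `E`, as `HasWeakDunfordPettis` requires.
  have hdown {u : ℕ → ℝ} (hu : Tendsto u atTop (𝓝 0)) :
      Tendsto (fun i : ULift.{u} ℕ => u i.down) cofinite (𝓝 0) := by
    rw [← Nat.cofinite_eq_atTop] at hu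
    exact hu.comp ULift.down_injective.tendsto_cofinite
  obtain ⟨M, hM⟩ := banach_steinhaus (g := f) fun y => by
    obtain ⟨C, hC⟩ := (hf0 y).norm.bddAbove_range
    exact ⟨C, fun n => hC ⟨n, rfl⟩⟩
  have hS := isWeaklyCompactOperator_nullOperator (fun i : ULift.{u} ℕ => f i.down)
    (fun y => hdown (hf0 y)) M (fun i => hM i.down) fun Φ => hdown (hΦ Φ.1 Φ.2)
  by_contra hcon
  obtain ⟨ε, hε, hfreq⟩ : ∃ ε > 0, ∃ᶠ n in atTop, ε ≤ f n (x n) := by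
    by_contra! H
    refine hcon (Metric.tendsto_nhds.2 fun ε hε => ?_)
    filter_upwards [H ε hε] with n hn
    rwa [Real.dist_0_eq_abs, abs_of_nonneg (hf n _ (hx n))]
  obtain ⟨C, hC⟩ := hnull.exists_norm_le
  obtain ⟨φ, v, hφ, hv0, hvx, hdisj, hev⟩ := exists_disjoint_of_frequently hx hC hf hf0 hε hfreq
  have hvnull : WeaklyNull v := WeaklyNull.of_nonneg_of_le
    (x := fun n => x (φ n)) (fun g => (hnull g).comp hφ.tendsto_atTop) hv0 hvx
  have hlim := hE _ _ hS v hvnull fun i j hij => by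
    rw [abs_of_nonneg (hv0 i), abs_of_nonneg (hv0 j), hdisj i j hij]
  obtain ⟨n, hn1, hn2⟩ := (hev.and (hlim.eventually_lt_const (by positivity : 0 < ε / 4))).exists
  have h3 := (norm_zeroAtInfty_le (norm_nonneg _)).1 (le_refl ‖nullOperator
    (fun i : ULift.{u} ℕ => f i.down) (fun y => hdown (hf0 y)) M (fun i => hM i.down) (v n)‖)
    ⟨φ n⟩
  exact absurd (hn1.trans ((le_abs_self _).trans h3)) (not_le.2 hn2)

theorem HasWeakDunfordPettis.tendsto_multilinear (hE : HasWeakDunfordPettis E) {x : ℕ → E}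
    (hx : ∀ n, 0 ≤ x n) (hnull : WeaklyNull x) (n : ℕ)
    (A : MultilinearMap ℝ (fun _ : Fin (n + 1) => E) ℝ)
    (hA : ∀ v : Fin (n + 1) → E, (∀ i, 0 ≤ v i) → 0 ≤ A v) :
    Tendsto (fun j => A fun _ => x j) atTop (𝓝 0) := by
  induction n with
  | zero =>
    let g : E →ₗ[ℝ] ℝ := A.toLinearMap 0 0
    have hg (y : E) : g y = A fun _ => y := by
      change A (Function.update 0 0 y) = _
      congr 1
      ext i
      rw [Fin.fin_one_eq_zero i]
      exact Function.update_self ..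
    have hb := exists_bound_of_nonneg g fun y hy => by rw [hg]; exact hA _ fun _ => hy
    exact (hnull (g.mkContinuousOfExistsBound hb)).congr fun j => hg (x j)
  | succ n ih =>
    let B : MultilinearMap ℝ (fun _ : Fin (n + 1) => E) (E →ₗ[ℝ] ℝ) := A.curryRight
    have hB (v : Fin (n + 1) → E) (hv : ∀ i, 0 ≤ v i) (y : E) (hy : 0 ≤ y) : 0 ≤ B v y := by
      refine hA _ fun i => ?_
      induction i using Fin.lastCases with
      | last => simpa using hy
      | cast i => simpa using hv i
    have hBd (a : E) : B (fun _ => a) a = A fun _ => a := by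
      change A (Fin.snoc (fun _ => a) a) = _
      congr 1
      ext i
      induction i using Fin.lastCases with
      | last => simp
      | cast i => simp
    have hΨ (Ψ : (E →ₗ[ℝ] ℝ) →ₗ[ℝ] ℝ)
        (hΨ : ∀ g : E →ₗ[ℝ] ℝ, (∀ y, 0 ≤ y → 0 ≤ g y) → 0 ≤ Ψ g) :
        Tendsto (fun j => Ψ (B fun _ => x j)) atTop (𝓝 0) :=
      ih (Ψ.compMultilinearMap B) fun v hv => hΨ _ (hB v hv)
    let f : ℕ → StrongDual ℝ E := fun j => (B fun _ => x j).mkContinuousOfExistsBound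
      (exists_bound_of_nonneg _ (hB _ fun _ => hx j))
    have hfB (j : ℕ) (y : E) : f j y = B (fun _ => x j) y := rfl
    refine (hE.tendsto_apply hx hnull (f := f) (fun j y hy => hB _ (fun _ => hx j) y hy)
      (fun y => ?_) (fun Φ hΦ => ?_)).congr fun j => hBd (x j)
    · have key (z : E) (hz : 0 ≤ z) : Tendsto (fun j => f j z) atTop (𝓝 0) :=
        hΨ (LinearMap.applyₗ z) fun g hg => hg z hz
      have h := (key _ (posPart_nonneg y)).sub (key _ (negPart_nonneg y))
      simpa only [← map_sub, posPart_sub_negPart, sub_zero] using h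
    -- A linear retraction `r` onto the continuous functionals extends `Φ` to the algebraic dual.
    -- Positivity survives because positive functionals are continuous.
    · obtain ⟨r, hr⟩ := LinearMap.exists_leftInverse_of_injective
        (ContinuousLinearMap.coeLM ℝ : (E →L[ℝ] ℝ) →ₗ[ℝ] (E →ₗ[ℝ] ℝ))
        (LinearMap.ker_eq_bot.2 ContinuousLinearMap.coe_injective)
      have hr' (g : StrongDual ℝ E) : r (g : E →ₗ[ℝ] ℝ) = g := LinearMap.congr_fun hr g
      refine (hΨ ((WeakDual.toStrongDual Φ).toLinearMap ∘ₗ r) fun g hg => ?_).congr fun j => ?_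
      · exact (hΦ.2 _ hg).trans_eq
          (congrArg Φ (hr' (g.mkContinuousOfExistsBound (exists_bound_of_nonneg g hg)))).symm
      · exact congrArg Φ (hr' (f j))

end Polynomial
end BanachLattice

theorem mainTheorem3 {E : Type u} [NormedAddCommGroup E] [NormedSpace ℝ E] [CompleteSpace E]
    [Lattice E] [HasSolidNorm E] [IsOrderedAddMonoid E] [IsOrderedModule ℝ E]
    (hE : BanachLattice.HasWeakDunfordPettis E)
    (x : ℕ → E) (hpos : ∀ j, 0 ≤ x j) (hnull : BanachLattice.WeaklyNull x)
    (n : ℕ) (hn : 1 ≤ n) (P : E → ℝ) (hP : BanachLattice.IsRegularPolynomial n P) :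
    Tendsto (fun j => P (x j)) atTop (𝓝 0) := by
  obtain ⟨P₁, P₂, ⟨A₁, -, hA₁, hP₁⟩, ⟨A₂, -, hA₂, hP₂⟩, hP⟩ := hP
  obtain ⟨n, rfl⟩ := Nat.exists_eq_add_of_le' hn
  simpa only [hP, hP₁, hP₂, sub_zero] using (hE.tendsto_multilinear hpos hnull n A₁ hA₁).sub
    (hE.tendsto_multilinear hpos hnull n A₂ hA₂)
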